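/- Let $n\ge 1$ and $N$ be integers with $N\ge 2n$. A frame for $\mathbb{R}^n$ is a finite sequence of vectors spanning $\mathbb{R}^n$; $(\varphi_i)_{i=1}^N$ is unit norm if $\|\varphi_i\|=1$ for all $i$, and tight if there is $A>0$ with $\sum_{i=1}^N|\langle x,\varphi_i\rangle|^2=A\|x\|^2$ for all $x\in\mathbb{R}^n$. For reals $\lambda_1,\dots,\lambda_n$ let $\mathcal F(N,\{\lambda_j\}_{j=1}^n)$ be the class of unit norm frames $(\varphi_i)_{i=1}^N$ for $\mathbb{R}^n$ whose frame operator $x\mapsto\sum_{i=1}^N\langle x,\varphi_i\rangle\varphi_i$ has eigenvalues $\lambda_1,\dots,\lambda_n$, counted with multiplicity. With respect to an orthonormal basis $(e_j)_{j=1}^n$ of $\mathbb{R}^n$, a frame $(\varphi_i)_{i=1}^N$ is called $k$-sparse if there are sets $J_i\subseteq\{1,\dots,n\}$ with $\varphi_i\in\operatorname{span}\{e_j:j\in J_i\}$ for all $i$ and $\sum_{i=1}^N|J_i|=k$. A frame in a class $\mathcal F$ of frames of $N$ vectors is optimally sparse in $\mathcal F$ if it is $k_1$-sparse for some $k_1$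 such that no frame in $\mathcal F$ is $k_2$-sparse with $k_2<k_1$. The maximal block number $\mu(\lambda_1,\dots,\lambda_n)$ is the maximum, over all permutations $\sigma$ of $\{1,\dots,n\}$, of the number of integers in the set $\{\sum_{j=1}^s\lambda_{\sigma(j)}: s=1,\dots,n\}$. Let $(e_j)_{j=1}^n$ be the standard unit vector basis. The Spectral Tetris algorithm produces $\mathrm{STF}(N;\lambda_1,\dots,\lambda_n)$ as follows. Set $i:=1$. For $j=1,\dots,n$, repeat the following until $\lambda_j=0$: if $\lambda_j<1$, put $\varphi_i:=\sqrt{\lambda_j/2}\,e_j+\sqrt{1-\lambda_j/2}\,e_{j+1}$ and $\varphi_{i+1}:=\sqrt{\lambda_j/2}\,e_j-\sqrt{1-\lambda_j/2}\,e_{j+1}$, then set $i:=i+2$, $\lambda_{j+1}:=\lambda_{j+1}-(2-\lambda_j)$ and $\lambda_j:=0$; otherwise put $\varphi_i:=e_j$, then set $i:=i+1$ and $\lambda_j:=\lambda_j-1$. The output is the sequence of the vectors $\varphi_i$. **Corollary.** For $\lambda_1=\dots=\lambda_n=\frac Nn$ the algorithm terminates after producing exactly $N$ vectors, and its output $\mathrm{STF}(N;\frac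 Nn,\dots,\frac Nn)$ is a unit norm tight frame for $\mathbb{R}^n$. With respect to the standard unit vector basis, it is optimally sparse in the class of all unit norm tight frames of $N$ vectors in $\mathbb{R}^n$, and likewise in $\mathcal F(N,\{\frac Nn\}_{j=1}^n)$. The smallest $k$ for which it is $k$-sparse is $$k=N+2\bigl(n-\gcd(N,n)\bigr),$$ and $\mu\bigl(\frac Nn,\dots,\frac Nn\bigr)=\gcd(N,n)$. -/

import Mathlib

namespace SpectralTetris

/-! ## Frames for `ℝⁿ` -/

section Frames

/-- The finite sequence `φ` is a frame for `ℝⁿ`: it spans `ℝⁿ`. -/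
def IsFrame {n N : ℕ} (φ : Fin N → EuclideanSpace ℝ (Fin n)) : Prop :=
  Submodule.span ℝ (Set.range φ) = ⊤

/-- All vectors of the sequence have norm one. -/
def IsUnitNorm {n N : ℕ} (φ : Fin N → EuclideanSpace ℝ (Fin n)) : Prop :=
  ∀ i, ‖φ i‖ = 1

/-- The sequence is `A`-tight for some frame bound `A > 0`. -/
def IsTight {n N : ℕ} (φ : Fin N → EuclideanSpace ℝ (Fin n)) : Prop :=
  ∃ A : ℝ, 0 < A ∧ ∀ x : EuclideanSpace ℝ (Fin n), ∑ i, |inner ℝ x (φ i)| ^ 2 = A * ‖x‖ ^ 2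

/-- The class of unit norm tight frames of `N` vectors in `ℝⁿ`. -/
def unitNormTightFrames (n N : ℕ) : Set (Fin N → EuclideanSpace ℝ (Fin n)) :=
  {φ | IsFrame φ ∧ IsUnitNorm φ ∧ IsTight φ}

/-- The frame operator `x ↦ ∑ i, ⟨x, φ i⟩ φ i`. -/
noncomputable def frameOperator {n N : ℕ} (φ : Fin N → EuclideanSpace ℝ (Fin n)) :
    EuclideanSpace ℝ (Fin n) →ₗ[ℝ] EuclideanSpace ℝ (Fin n) where
  toFun x := ∑ i, inner ℝ x (φ i) • φ i
  map_add' x y := by simp [inner_add_left, add_smul, Finset.sum_add_distrib]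
  map_smul' c x := by simp [real_inner_smul_left, mul_smul, Finset.smul_sum]

/-- The class `F(N, {lam_j})` of unit norm frames of `N` vectors in `ℝⁿ` whose frame operator has
the eigenvalues `lam_1, …, lam_n`, counted with multiplicity, in any order. -/
def frameClass {n : ℕ} (N : ℕ) (lam : Fin n → ℝ) : Set (Fin N → EuclideanSpace ℝ (Fin n)) :=
  {φ | IsFrame φ ∧ IsUnitNorm φ ∧
    (frameOperator φ).charpoly.roots = (Finset.univ : Finset (Fin n)).val.map lam}

end Frames

/-! ## Sparsity -/

section Sparsity

/-- The sequence `φ` is `k`-sparse with respect to the orthonormal basis `b`: each `φ i` lies in the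
span of the basis vectors with index in some set `J i`, and the sizes of these sets sum to `k`. -/
def IsSparse {n N : ℕ} (b : OrthonormalBasis (Fin n) ℝ (EuclideanSpace ℝ (Fin n))) (k : ℕ)
    (φ : Fin N → EuclideanSpace ℝ (Fin n)) : Prop :=
  ∃ J : Fin N → Finset (Fin n),
    (∀ i, φ i ∈ Submodule.span ℝ (b '' (J i : Set (Fin n)))) ∧ ∑ i, (J i).card = k

/-- `φ` is optimally sparse in the class `F` with respect to the orthonormal basis `b`. -/
def IsOptimallySparse {n N : ℕ} (b : OrthonormalBasis (Fin n) ℝ (EuclideanSpace ℝ (Fin n)))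
    (F : Set (Fin N → EuclideanSpace ℝ (Fin n))) (φ : Fin N → EuclideanSpace ℝ (Fin n)) : Prop :=
  φ ∈ F ∧ ∃ k₁ : ℕ, IsSparse b k₁ φ ∧ ¬ ∃ ψ ∈ F, ∃ k₂ : ℕ, k₂ < k₁ ∧ IsSparse b k₂ ψ

end Sparsity

/-! ## Maximal block number -/

section BlockNumber

/-- The number of integers in the set of partial sums `lam_1 + ⋯ + lam_s`, `s = 1, …, n`. -/
noncomputable def integerPartialSums {n : ℕ} (lam : Fin n → ℝ) : ℕ :=
  {x : ℝ | (∃ s : Fin n, x = ∑ j ∈ Finset.Iic s, lam j) ∧ ∃ z : ℤ, x = z}.ncard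

/-- `lam` is ordered blockwise: no rearrangement has more integers among its partial sums. -/
def OrderedBlockwise {n : ℕ} (lam : Fin n → ℝ) : Prop :=
  ∀ π : Equiv.Perm (Fin n), integerPartialSums (lam ∘ π) ≤ integerPartialSums lam

/-- The maximal block number: the largest number of integers among the partial sums of a
rearrangement of `lam`, that is, the number attained by the rearrangements ordered blockwise (see
`maximalBlockNumber_eq` and `exists_orderedBlockwise`). -/
noncomputable def maximalBlockNumber {n : ℕ} (lam : Fin n → ℝ) : ℕ :=
  (Finset.univ : Finset (Equiv.Perm (Fin n))).sup fun σ => integerPartialSums (lam ∘ σ)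

theorem maximalBlockNumber_eq {n : ℕ} (lam : Fin n → ℝ) (σ : Equiv.Perm (Fin n))
    (h : OrderedBlockwise (lam ∘ σ)) :
    maximalBlockNumber lam = integerPartialSums (lam ∘ σ) := by
  apply le_antisymm
  · refine Finset.sup_le fun τ _ => ?_
    have h1 := h (σ⁻¹ * τ)
    have h2 : (lam ∘ σ) ∘ (σ⁻¹ * τ : Equiv.Perm (Fin n)) = lam ∘ τ := by
      funext i
      simp
    rwa [h2] at h1
  · exact Finset.le_sup (f := fun τ : Equiv.Perm (Fin n) => integerPartialSums (lam ∘ τ))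
      (Finset.mem_univ σ)

theorem exists_orderedBlockwise {n : ℕ} (lam : Fin n → ℝ) :
    ∃ σ : Equiv.Perm (Fin n), OrderedBlockwise (lam ∘ σ) := by
  obtain ⟨σ, hσ⟩ := Finite.exists_max fun σ : Equiv.Perm (Fin n) => integerPartialSums (lam ∘ σ)
  exact ⟨σ, fun π => hσ (σ * π)⟩

end BlockNumber

/-! ## The Spectral Tetris algorithm -/

section Algorithm

/-- The memory of the algorithm. Indices start at `0`: `row` is the current row `j`, `idx` is the
index `i` of the next vector to be written (so `idx` vectors have been written), `lam` holds the
current values of the variables `lam_j`, and `out` the vectors written so far. -/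
structure State (n : ℕ) where
  row : ℕ
  idx : ℕ
  lam : ℕ → ℝ
  out : ℕ → EuclideanSpace ℝ (Fin n)

/-- The standard unit vector `e_j` of `ℝⁿ` (the zero vector if `j` is not a valid index). -/
noncomputable def stdVec (n j : ℕ) : EuclideanSpace ℝ (Fin n) :=
  WithLp.toLp 2 fun k => if (k : ℕ) = j then 1 else 0

/-- The state before the first row is treated. -/
noncomputable def init {n : ℕ} (lam : Fin n → ℝ) : State n where
  row := 0
  idx := 0
  lam j := if h : j < n then lam ⟨j, h⟩ else 0
  out _ := 0

/-- One execution of the body of the `repeat` loop. -/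
noncomputable def body {n : ℕ} (s : State n) : State n :=
  if s.lam s.row < 1 then
    { row := s.row
      idx := s.idx + 2
      lam := Function.update
        (Function.update s.lam (s.row + 1) (s.lam (s.row + 1) - (2 - s.lam s.row))) s.row 0
      out := Function.update
        (Function.update s.out s.idx
          (√(s.lam s.row / 2) • stdVec n s.row + √(1 - s.lam s.row / 2) • stdVec n (s.row + 1)))
        (s.idx + 1)
          (√(s.lam s.row / 2) • stdVec n s.row - √(1 - s.lam s.row / 2) • stdVec n (s.row + 1)) }
  else
    { row := s.row
      idx := s.idx + 1
      lam := Function.update s.lam s.row (s.lam s.row - 1)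
      out := Function.update s.out s.idx (stdVec n s.row) }

/-- One iteration: execute the body of the `repeat` loop and, if the test `until lam_j = 0`
succeeds, move on to the next row. Nothing happens once all `n` rows are done. -/
noncomputable def step {n : ℕ} (s : State n) : State n :=
  if s.row < n then
    if (body s).lam s.row = 0 then { body s with row := s.row + 1 } else body s
  else s

/-- The state after `N` iterations. Each iteration of a running algorithm writes at least one
vector, so `N` iterations are enough whenever the algorithm stops with `N` vectors. -/
noncomputable def finalState {n : ℕ} (N : ℕ) (lam : Fin n → ℝ) : State n :=
  step^[N] (init lam)

/-- The algorithm has treated all `n` rows and has written exactly `N` vectors. -/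
def Terminates {n : ℕ} (N : ℕ) (lam : Fin n → ℝ) : Prop :=
  (finalState N lam).row = n ∧ (finalState N lam).idx = N

/-- The output `STF(N; lam_1, …, lam_n)`. -/
noncomputable def STF {n : ℕ} (N : ℕ) (lam : Fin n → ℝ) : Fin N → EuclideanSpace ℝ (Fin n) :=
  fun i => (finalState N lam).out i

end Algorithm

end SpectralTetris

namespace SpectralTetris

/-! ### Sparsity and supports -/

/-! Both classes consist of the unit norm sequences whose synthesis matrix has orthogonal rows of
squared norm `N / n` (`mem_unitNormTightFrames_iff`, `frameClass_const_eq`). Sparsity counts the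
nonzero entries of this matrix, which number `N` plus the total excess, the sum over the vectors of
support size minus one.

Lower bound: put `m = n / gcd(N, n)` and build up the set of all rows one row at a time. A set `S`
of rows that shares no vector with its complement has integral total weight `S.card * N / n`, so `m`
divides `S.card` (`dvd_card_of_closed`). At every other size some outside row meets a row of `S`.
Being orthogonal, the two rows share at least two vectors (`two_le_card_common`), and adding the
outside row raises the excess by at least 2. Only `gcd(N, n)` of the `n` additions can be free, so
the excess is at least `2 * (n - gcd(N, n))` (`exists_rows_excess`).

Upper bound: the algorithm writes a pair of two-entry vectors only at the end of a row where the
partial sum of eigenvalues is not an integer. This happens for at most `n - gcd(N, n)` rows and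
costs excess at most 2 each time. `Invariant` carries this count together with the row inner
products. The assumption `2 * n ≤ N` keeps the next row positive after a pair. -/

theorem isSparse_basisFun_iff {n N k : ℕ} (φ : Fin N → EuclideanSpace ℝ (Fin n)) :
    IsSparse (EuclideanSpace.basisFun (Fin n) ℝ) k φ ↔
      ∃ J : Fin N → Finset (Fin n), (∀ i a, φ i a ≠ 0 → a ∈ J i) ∧ ∑ i, (J i).card = k := by
  unfold IsSparse
  refine exists_congr fun J => and_congr_left fun _ => forall_congr' fun i => ?_
  rw [← OrthonormalBasis.coe_toBasis, Module.Basis.mem_span_image]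
  simp [Set.subset_def]

/-! ### Frames whose rows are orthogonal and of equal norm -/

/-- The rows of the synthesis matrix of `φ` are orthogonal, with squared norm `c`. -/
def HasFlatRows {n N : ℕ} (φ : Fin N → EuclideanSpace ℝ (Fin n)) (c : ℝ) : Prop :=
  ∀ a b, ∑ i, φ i a * φ i b = if a = b then c else 0

theorem sum_sum_sq_of_isUnitNorm {n N : ℕ} {φ : Fin N → EuclideanSpace ℝ (Fin n)}
    (h : IsUnitNorm φ) : ∑ a, ∑ i, φ i a * φ i a = N := by
  rw [Finset.sum_comm]
  have : ∀ i, ∑ a, φ i a * φ i a = 1 := fun i => by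
    have h1 := EuclideanSpace.real_norm_sq_eq (φ i)
    rw [h i] at h1
    simpa [sq] using h1.symm
  simp [this]

theorem frameOperator_apply_apply {n N : ℕ} (φ : Fin N → EuclideanSpace ℝ (Fin n))
    (x : EuclideanSpace ℝ (Fin n)) (a : Fin n) :
    frameOperator φ x a = ∑ b, x b * ∑ i, φ i a * φ i b := by
  simp only [frameOperator, LinearMap.coe_mk, AddHom.coe_mk, WithLp.ofLp_sum, Finset.sum_apply,
    PiLp.smul_apply, smul_eq_mul, PiLp.inner_apply, Finset.mul_sum, Finset.sum_mul]
  rw [Finset.sum_comm]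
  refine Finset.sum_congr rfl fun b _ => Finset.sum_congr rfl fun i _ => ?_
  simp
  ring

/-- In the standard basis the matrix of the frame operator is the Gram matrix of the rows. -/
theorem hasFlatRows_iff_frameOperator {n N : ℕ} (φ : Fin N → EuclideanSpace ℝ (Fin n)) (c : ℝ) :
    HasFlatRows φ c ↔ frameOperator φ = c • LinearMap.id := by
  constructor
  · intro h
    ext x a
    rw [frameOperator_apply_apply]
    simp [h a, mul_comm]
  · intro h a b
    have h1 := frameOperator_apply_apply φ (EuclideanSpace.single b 1) a
    rw [h] at h1
    simpa [Pi.single_apply, eq_comm] using h1.symm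

theorem inner_frameOperator {n N : ℕ} (φ : Fin N → EuclideanSpace ℝ (Fin n))
    (x y : EuclideanSpace ℝ (Fin n)) :
    inner ℝ (frameOperator φ x) y = ∑ i, inner ℝ x (φ i) * inner ℝ y (φ i) := by
  change inner ℝ (∑ i, inner ℝ x (φ i) • φ i) y = _
  simp only [sum_inner, real_inner_smul_left]
  exact Finset.sum_congr rfl fun i _ => by rw [real_inner_comm y]

theorem frameOperator_isSymmetric {n N : ℕ} (φ : Fin N → EuclideanSpace ℝ (Fin n)) :
    (frameOperator φ).IsSymmetric := fun x y => by
  rw [inner_frameOperator, real_inner_comm, inner_frameOperator]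
  simp [mul_comm]

theorem HasFlatRows.isTight {n N : ℕ} {φ : Fin N → EuclideanSpace ℝ (Fin n)} {c : ℝ}
    (hc : 0 < c) (h : HasFlatRows φ c) : IsTight φ := by
  refine ⟨c, hc, fun x => ?_⟩
  have h1 := inner_frameOperator φ x x
  rw [(hasFlatRows_iff_frameOperator φ c).1 h] at h1
  simp only [sq_abs]
  simp only [LinearMap.smul_apply, LinearMap.id_apply, real_inner_smul_left,
    real_inner_self_eq_norm_sq] at h1
  simp only [sq (inner ℝ x _), ← h1]

theorem HasFlatRows.isFrame {n N : ℕ} {φ : Fin N → EuclideanSpace ℝ (Fin n)} {c : ℝ}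
    (hc : c ≠ 0) (h : HasFlatRows φ c) : IsFrame φ := by
  refine eq_top_iff.2 fun x _ => ?_
  have h1 : frameOperator φ x = c • x := by rw [(hasFlatRows_iff_frameOperator φ c).1 h]; rfl
  have h2 : x = c⁻¹ • frameOperator φ x := by rw [h1, inv_smul_smul₀ hc]
  rw [h2]
  change c⁻¹ • ∑ i, inner ℝ x (φ i) • φ i ∈ _
  exact Submodule.smul_mem _ _ (Submodule.sum_mem _ fun i _ =>
    Submodule.smul_mem _ _ (Submodule.subset_span (Set.mem_range_self i)))

theorem HasFlatRows.roots_charpoly {n N : ℕ} {φ : Fin N → EuclideanSpace ℝ (Fin n)} {c : ℝ}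
    (h : HasFlatRows φ c) :
    (frameOperator φ).charpoly.roots = (Finset.univ : Finset (Fin n)).val.map fun _ => c := by
  rw [(hasFlatRows_iff_frameOperator φ c).1 h,
    ← LinearMap.charpoly_toMatrix _ (EuclideanSpace.basisFun (Fin n) ℝ).toBasis]
  have h1 : LinearMap.toMatrix (EuclideanSpace.basisFun (Fin n) ℝ).toBasis
      (EuclideanSpace.basisFun (Fin n) ℝ).toBasis (c • LinearMap.id) =
      Matrix.diagonal fun _ => c := by
    rw [map_smul, LinearMap.toMatrix_id, Matrix.smul_one_eq_diagonal]
  rw [h1, Matrix.charpoly_diagonal]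
  simp [Polynomial.roots_pow, Multiset.nsmul_singleton]

/-- The frame operator is symmetric, hence has an orthonormal eigenbasis. With `c` as the only
eigenvalue it is `c` times the identity. -/
theorem hasFlatRows_of_roots {n N : ℕ} {φ : Fin N → EuclideanSpace ℝ (Fin n)} {c : ℝ}
    (h : (frameOperator φ).charpoly.roots = (Finset.univ : Finset (Fin n)).val.map fun _ => c) :
    HasFlatRows φ c := by
  rw [hasFlatRows_iff_frameOperator]
  have hs := frameOperator_isSymmetric φ
  have hn : Module.finrank ℝ (EuclideanSpace ℝ (Fin n)) = n := by simp
  refine (hs.eigenvectorBasis hn).toBasis.ext fun i => ?_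
  have h2 : hs.eigenvalues hn i = c := by
    have h3 := (hs.hasEigenvalue_eigenvalues hn i)
    rw [Module.End.hasEigenvalue_iff_isRoot_charpoly,
      ← Polynomial.mem_roots (LinearMap.charpoly_monic _).ne_zero] at h3
    have h4 : hs.eigenvalues hn i ∈ (frameOperator φ).charpoly.roots := h3
    rw [h, Multiset.mem_map] at h4
    obtain ⟨_, _, h5⟩ := h4
    exact h5.symm
  simp [h2]

/-- Testing tightness on `e_a` gives every row squared norm `A`, and counting the total weight by
vectors gives `n * A = N`. Testing on `e_a + e_b` then leaves no room for the cross term. -/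
theorem IsTight.hasFlatRows {n N : ℕ} {φ : Fin N → EuclideanSpace ℝ (Fin n)} (hn : 0 < n)
    (hu : IsUnitNorm φ) (h : IsTight φ) : HasFlatRows φ ((N : ℝ) / n) := by
  obtain ⟨A, hA, h⟩ := h
  have hd : ∀ a, ∑ i, φ i a * φ i a = A := fun a => by
    have := h (EuclideanSpace.single a 1)
    simpa [EuclideanSpace.inner_single_left, sq] using this
  have hA' : A = (N : ℝ) / n := by
    have h1 := sum_sum_sq_of_isUnitNorm hu
    simp only [hd, Finset.sum_const, Finset.card_univ, Fintype.card_fin, nsmul_eq_mul] at h1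
    rw [← h1]
    field_simp
  intro a b
  split_ifs with hab
  · subst hab; rw [hd, hA']
  · have h1 := h (EuclideanSpace.single a 1 + EuclideanSpace.single b 1)
    have h2 : ‖(EuclideanSpace.single a 1 + EuclideanSpace.single b 1 :
        EuclideanSpace ℝ (Fin n))‖ ^ 2 = 2 := by
      rw [norm_add_sq_real]
      simp [EuclideanSpace.inner_single_left, hab]
      norm_num
    rw [h2] at h1
    simp only [inner_add_left, EuclideanSpace.inner_single_left, sq_abs, map_one, one_mul] at h1
    have h3 : ∑ i, (φ i a + φ i b) ^ 2 =
        ∑ i, φ i a * φ i a + ∑ i, φ i b * φ i b + 2 * ∑ i, φ i a * φ i b := by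
      rw [Finset.mul_sum, ← Finset.sum_add_distrib, ← Finset.sum_add_distrib]
      exact Finset.sum_congr rfl fun i _ => by ring
    rw [h3, hd, hd] at h1
    linarith

theorem mem_unitNormTightFrames_iff {n N : ℕ} (hn : 0 < n) (hN : 0 < N)
    (φ : Fin N → EuclideanSpace ℝ (Fin n)) :
    φ ∈ unitNormTightFrames n N ↔ IsUnitNorm φ ∧ HasFlatRows φ ((N : ℝ) / n) := by
  have hc : (0 : ℝ) < (N : ℝ) / n := by positivity
  exact ⟨fun h => ⟨h.2.1, h.2.2.hasFlatRows hn h.2.1⟩,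
    fun h => ⟨h.2.isFrame hc.ne', h.1, h.2.isTight hc⟩⟩

theorem frameClass_const_eq {n N : ℕ} (hn : 0 < n) (hN : 0 < N) :
    frameClass N (fun _ : Fin n => (N : ℝ) / n) = unitNormTightFrames n N := by
  ext φ
  rw [mem_unitNormTightFrames_iff hn hN]
  have hc : (0 : ℝ) < (N : ℝ) / n := by positivity
  exact ⟨fun h => ⟨h.2.1, hasFlatRows_of_roots h.2.2⟩,
    fun h => ⟨h.2.isFrame hc.ne', h.1, h.2.roots_charpoly⟩⟩

/-! ### The lower bound for the sparsity -/

/-- If a set `S` of rows shares no vector with its complement, then `S.card * N / n` is an integer. -/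
theorem dvd_card_of_closed {n N : ℕ} (hn : 0 < n) {φ : Fin N → EuclideanSpace ℝ (Fin n)}
    (hu : IsUnitNorm φ) (h : HasFlatRows φ ((N : ℝ) / n)) (S : Finset (Fin n))
    (hS : ∀ i, ∀ a ∈ S, ∀ b ∉ S, φ i a = 0 ∨ φ i b = 0) : n ∣ S.card * N := by
  have h0 : ∀ i, ∑ a, φ i a * φ i a = 1 := fun i => by
    have h1 := EuclideanSpace.real_norm_sq_eq (φ i)
    rw [hu i] at h1
    simpa [sq] using h1.symm
  -- Each vector is supported either inside `S` or outside it, so its weight on `S` is 1 or 0.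
  have h1 : ∀ i, ∃ e : ℕ, ∑ a ∈ S, φ i a * φ i a = e := fun i => by
    by_cases hi : ∃ a ∈ S, φ i a ≠ 0
    · obtain ⟨a, ha, hne⟩ := hi
      refine ⟨1, ?_⟩
      rw [Nat.cast_one, ← h0 i]
      refine Finset.sum_subset (Finset.subset_univ S) fun b _ hb => ?_
      simp [(hS i a ha b hb).resolve_left hne]
    · push Not at hi
      exact ⟨0, by rw [Nat.cast_zero]; exact Finset.sum_eq_zero fun a ha => by simp [hi a ha]⟩
  choose e he using h1
  -- The weight on `S`, counted by rows and by vectors.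
  have h2 : (S.card : ℝ) * (N / n) = ∑ i, (e i : ℝ) := by
    simp_rw [← he]
    rw [Finset.sum_comm]
    simp [h _ _]
  refine ⟨∑ i, e i, ?_⟩
  have hn' : (n : ℝ) ≠ 0 := by positivity
  have h3 : (S.card : ℝ) * N = n * ∑ i, (e i : ℝ) := by
    rw [← h2]; field_simp
  exact_mod_cast h3

/-- Two orthogonal rows that share a vector share at least two. -/
theorem two_le_card_common {n N : ℕ} {φ : Fin N → EuclideanSpace ℝ (Fin n)} {c : ℝ}
    (h : HasFlatRows φ c) {a b : Fin n} (hab : a ≠ b) {i : Fin N} (ha : φ i a ≠ 0)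
    (hb : φ i b ≠ 0) : 2 ≤ (Finset.univ.filter fun i => φ i a ≠ 0 ∧ φ i b ≠ 0).card := by
  by_contra hlt
  have hi : i ∈ Finset.univ.filter fun i => φ i a ≠ 0 ∧ φ i b ≠ 0 := by simp [ha, hb]
  have h1 := Finset.card_le_one.1 (Nat.lt_succ_iff.1 (not_le.1 hlt))
  have h2 := h a b
  -- With `i` the only common vector, the inner product would be a single nonzero term.
  rw [if_neg hab, Finset.sum_eq_single i] at h2
  · exact mul_ne_zero ha hb h2
  · intro j _ hj
    by_contra hne
    exact hj (h1 j (by simpa using (mul_ne_zero_iff.1 hne)) i hi)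
  · simp

/-- Adding a row `b` to `S` adds to the total excess the number of vectors that meet both. -/
theorem sum_excess_insert {n N : ℕ} (T : Fin N → Finset (Fin n)) (S : Finset (Fin n)) {b : Fin n}
    (hb : b ∉ S) : ∑ i, ((T i ∩ insert b S).card - 1) = ∑ i, ((T i ∩ S).card - 1) +
      (Finset.univ.filter fun i => b ∈ T i ∧ (T i ∩ S).Nonempty).card := by
  rw [Finset.card_filter, ← Finset.sum_add_distrib]
  refine Finset.sum_congr rfl fun i _ => ?_
  by_cases h : b ∈ T i
  · rw [Finset.inter_insert_of_mem h, Finset.card_insert_of_notMem (by simp [hb])]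
    -- Subtraction is truncated: a vector missing `S` has excess 0, and still 0 once it meets only
    -- `b`.
    by_cases h' : (T i ∩ S).Nonempty
    · have := h'.card_pos
      simp only [h, h', and_self, if_true]
      omega
    · simp [h, Finset.not_nonempty_iff_eq_empty.1 h']
  · rw [Finset.inter_insert_of_notMem h]
    simp [h]

/-- The quotient is `⌈s / m⌉`, the number of multiples of `m` among the sizes `0, …, s - 1`. These
are the only sizes at which the next row may add no excess. -/
theorem exists_rows_excess {n N : ℕ} (hn : 0 < n) {φ : Fin N → EuclideanSpace ℝ (Fin n)}
    (hu : IsUnitNorm φ) (h : HasFlatRows φ ((N : ℝ) / n)) {m : ℕ} (hm : 0 < m)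
    (hdvd : ∀ s, n ∣ s * N → m ∣ s) (s : ℕ) (hs : s ≤ n) :
    ∃ S : Finset (Fin n), S.card = s ∧ 2 * s ≤
      ∑ i, (((Finset.univ.filter fun a => φ i a ≠ 0) ∩ S).card - 1) + 2 * ((s + (m - 1)) / m) := by
  induction s with
  | zero => exact ⟨∅, by simp⟩
  | succ s ih =>
    obtain ⟨S, hcard, hS⟩ := ih (by omega)
    -- Here `S` may be closed: any new row will do, as the ceiling grows by one and pays the 2.
    by_cases hms : m ∣ s
    · obtain ⟨b, hb⟩ : ∃ b, b ∉ S := by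
        by_contra! hall
        have : S = Finset.univ := Finset.eq_univ_iff_forall.2 hall
        rw [this, Finset.card_univ, Fintype.card_fin] at hcard
        omega
      refine ⟨insert b S, by rw [Finset.card_insert_of_notMem hb, hcard], ?_⟩
      rw [sum_excess_insert _ _ hb]
      obtain ⟨q, rfl⟩ := hms
      have h1 : (m * q + (m - 1)) / m = q := by
        rw [Nat.mul_add_div hm, Nat.div_eq_of_lt (by omega), add_zero]
      have h2 : (m * q + 1 + (m - 1)) / m = q + 1 := by
        rw [show m * q + 1 + (m - 1) = m * q + m by omega, Nat.mul_add_div hm, Nat.div_self hm]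
      rw [h1] at hS
      rw [h2]
      omega
    -- Here `S` is not closed, and the new row is chosen to share a vector with a row of `S`.
    · have h1 : ¬ ∀ i, ∀ a ∈ S, ∀ b ∉ S, φ i a = 0 ∨ φ i b = 0 := fun hcl =>
        hms (hdvd s (hcard ▸ dvd_card_of_closed hn hu h S hcl))
      push Not at h1
      obtain ⟨i, a, ha, b, hb, hia, hib⟩ := h1
      refine ⟨insert b S, by rw [Finset.card_insert_of_notMem hb, hcard], ?_⟩
      rw [sum_excess_insert _ _ hb]
      have h2 := two_le_card_common h (fun hab => hb (hab ▸ ha) : a ≠ b) hia hib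
      have h3 : (Finset.univ.filter fun i => φ i a ≠ 0 ∧ φ i b ≠ 0) ⊆
          Finset.univ.filter fun i => b ∈ (Finset.univ.filter fun a => φ i a ≠ 0) ∧
            ((Finset.univ.filter fun a => φ i a ≠ 0) ∩ S).Nonempty := by
        intro j hj
        simp only [Finset.mem_filter, Finset.mem_univ, true_and] at hj ⊢
        exact ⟨hj.2, a, by simp [hj.1, ha]⟩
      have h4 := Finset.card_le_card h3
      have h5 : (s + (m - 1)) / m ≤ (s + 1 + (m - 1)) / m := Nat.div_le_div_right (by omega)
      omega

theorem div_gcd_dvd_iff {n N : ℕ} (hn : 0 < n) (s : ℕ) : n / Nat.gcd N n ∣ s ↔ n ∣ s * N := by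
  have hg : 0 < Nat.gcd N n := Nat.gcd_pos_of_pos_right _ hn
  have hco : Nat.Coprime (N / Nat.gcd N n) (n / Nat.gcd N n) := Nat.coprime_div_gcd_div_gcd hg
  constructor
  · rintro ⟨q, rfl⟩
    refine ⟨q * (N / Nat.gcd N n), ?_⟩
    have h1 := Nat.div_mul_cancel (Nat.gcd_dvd_left N n)
    have h2 := Nat.div_mul_cancel (Nat.gcd_dvd_right N n)
    calc n / Nat.gcd N n * q * N = n / Nat.gcd N n * q * (N / Nat.gcd N n * Nat.gcd N n) := by
          rw [h1]
      _ = n / Nat.gcd N n * Nat.gcd N n * (q * (N / Nat.gcd N n)) := by ring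
      _ = _ := by rw [h2]
  · intro h
    refine hco.symm.dvd_of_dvd_mul_right ?_
    refine Nat.dvd_of_mul_dvd_mul_left hg ?_
    rwa [mul_left_comm, Nat.mul_div_cancel' (Nat.gcd_dvd_left N n),
      Nat.mul_div_cancel' (Nat.gcd_dvd_right N n)]

theorem le_sum_card_support {n N : ℕ} (hn : 0 < n) {φ : Fin N → EuclideanSpace ℝ (Fin n)}
    (hu : IsUnitNorm φ) (h : HasFlatRows φ ((N : ℝ) / n)) :
    N + 2 * (n - Nat.gcd N n) ≤ ∑ i, (Finset.univ.filter fun a => φ i a ≠ 0).card := by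
  have hg : 0 < Nat.gcd N n := Nat.gcd_pos_of_pos_right _ hn
  have hm : 0 < n / Nat.gcd N n := Nat.div_pos (Nat.gcd_le_right _ hn) hg
  obtain ⟨S, hS, hle⟩ := exists_rows_excess hn hu h hm
    (fun s hs => (div_gcd_dvd_iff hn s).2 hs) n le_rfl
  have hS' : S = Finset.univ := by rw [← Finset.card_eq_iff_eq_univ, hS, Fintype.card_fin]
  have h1 : (n + (n / Nat.gcd N n - 1)) / (n / Nat.gcd N n) = Nat.gcd N n := by
    have h2 := Nat.div_mul_cancel (Nat.gcd_dvd_right N n)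
    generalize n / Nat.gcd N n = m at *
    rw [← h2, Nat.mul_add_div hm, Nat.div_eq_of_lt (by omega)]
    simp [h2]
  simp only [hS', Finset.inter_univ, h1] at hle
  have h3 : ∑ i, (Finset.univ.filter fun a => φ i a ≠ 0).card =
      N + ∑ i, ((Finset.univ.filter fun a => φ i a ≠ 0).card - 1) := by
    have h4 : N + ∑ i, ((Finset.univ.filter fun a => φ i a ≠ 0).card - 1) =
        ∑ i, (1 + ((Finset.univ.filter fun a => φ i a ≠ 0).card - 1)) := by
      rw [Finset.sum_add_distrib]
      simp
    rw [h4]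
    refine Finset.sum_congr rfl fun i _ => ?_
    -- A unit vector has nonempty support, so the truncated subtraction is exact.
    have hpos : 0 < (Finset.univ.filter fun a => φ i a ≠ 0).card := by
      rw [Finset.card_pos]
      by_contra hem
      have h4 : φ i = 0 := by
        ext a
        by_contra hne
        exact hem ⟨a, by simpa using hne⟩
      have h5 := hu i
      simp [h4] at h5
    omega
  omega

/-! ### Counting integral partial sums -/

theorem card_filter_dvd {n N : ℕ} (hn : 0 < n) :
    ((Finset.range n).filter fun j => n ∣ (j + 1) * N).card = Nat.gcd N n := by
  simp_rw [← div_gcd_dvd_iff hn]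
  rw [Nat.card_multiples, Nat.div_div_self (Nat.gcd_dvd_right N n) hn.ne']

theorem integerPartialSums_const {n N : ℕ} (hn : 0 < n) (hN : 0 < N) :
    integerPartialSums (fun _ : Fin n => (N : ℝ) / n) = Nat.gcd N n := by
  have hn' : (n : ℝ) ≠ 0 := by positivity
  rw [← card_filter_dvd hn, ← Set.ncard_coe_finset]
  unfold integerPartialSums
  symm
  -- The partial sums are distinct because `N / n ≠ 0`, so counting values is counting indices.
  have hinj : Function.Injective fun j : ℕ => ((j : ℝ) + 1) * (N / n) := by
    intro i j hij
    have : (N : ℝ) / n ≠ 0 := by positivity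
    simpa [this] using hij
  rw [← Set.ncard_image_of_injective _ hinj]
  congr 1
  ext x
  simp only [Finset.coe_filter, Finset.mem_range, Set.mem_image, Set.mem_ofPred_eq,
    Finset.sum_const, Fin.card_Iic, nsmul_eq_mul]
  constructor
  · rintro ⟨j, ⟨hj, q, hq⟩, rfl⟩
    refine ⟨⟨⟨j, hj⟩, by push_cast; ring⟩, q, ?_⟩
    have : ((j : ℝ) + 1) * N = n * q := by exact_mod_cast hq
    rw [← mul_div_assoc, this]
    field_simp
    simp
  · rintro ⟨⟨s, rfl⟩, z, hz⟩
    refine ⟨s, ⟨s.2, ?_⟩, by push_cast; ring⟩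
    have h1 : (((s : ℕ) + 1 : ℕ) : ℝ) * N = n * z := by
      rw [← hz]; field_simp
    have h2 : (n : ℤ) ∣ ((((s : ℕ) + 1) * N : ℕ) : ℤ) := ⟨z, by exact_mod_cast h1⟩
    exact Int.natCast_dvd_natCast.1 h2

theorem maximalBlockNumber_const {n N : ℕ} (hn : 0 < n) (hN : 0 < N) :
    maximalBlockNumber (fun _ : Fin n => (N : ℝ) / n) = Nat.gcd N n := by
  unfold maximalBlockNumber
  simp only [Function.comp_def]
  rw [Finset.sup_const Finset.univ_nonempty, integerPartialSums_const hn hN]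

/-! ### Correctness of the algorithm -/

theorem stdVec_apply {n : ℕ} (j : ℕ) (a : Fin n) :
    stdVec n j a = if (a : ℕ) = j then 1 else 0 := rfl

theorem stdVec_eq_single {n j : ℕ} (h : j < n) :
    stdVec n j = EuclideanSpace.single ⟨j, h⟩ 1 := by
  ext a
  simp [stdVec_apply, Fin.ext_iff]

/-- The number of rows among the first `r` at whose end the partial sum of the eigenvalues is not an
integer. -/
def cutRows (n N r : ℕ) : ℕ :=
  ((Finset.range r).filter fun j => ¬ n ∣ (j + 1) * N).card

theorem cutRows_succ (n N r : ℕ) :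
    cutRows n N (r + 1) = cutRows n N r + if n ∣ (r + 1) * N then 0 else 1 := by
  unfold cutRows
  rw [Finset.range_add_one, Finset.filter_insert]
  split_ifs with h
  · rfl
  · rw [Finset.card_insert_of_notMem (by simp)]

theorem cutRows_self {n N : ℕ} (hn : 0 < n) : cutRows n N n = n - Nat.gcd N n := by
  have h := Finset.card_filter_add_card_filter_not (s := Finset.range n)
    (fun j => n ∣ (j + 1) * N)
  rw [card_filter_dvd hn, Finset.card_range] at h
  unfold cutRows
  omega

/-- The loop invariant of the algorithm for constant eigenvalues `N / n`. -/
structure Invariant (n N : ℕ) (s : State n) : Prop where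
  row_le : s.row ≤ n
  lam_row : s.row < n → s.lam s.row = (s.row + 1) * ((N : ℝ) / n) - s.idx
  lam_row_pos : s.row < n → 0 < s.lam s.row
  lam_of_lt : ∀ a < s.row, s.lam a = 0
  lam_of_gt : ∀ a, s.row < a → a < n → s.lam a = (N : ℝ) / n
  idx_eq : s.row = n → s.idx = N
  norm_out : ∀ k < s.idx, ‖s.out k‖ = 1
  -- `lam a` is the weight row `a` still lacks. Once it is 0 for every row, this says that the rows
  -- are flat.
  gram : ∀ a b : Fin n, ∑ k ∈ Finset.range s.idx, s.out k a * s.out k b =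
    if a = b then (N : ℝ) / n - s.lam a else 0
  card_support : ∑ k ∈ Finset.range s.idx, (Finset.univ.filter fun a => s.out k a ≠ 0).card ≤
    s.idx + 2 * cutRows n N s.row

theorem sum_range_succ_update {E M : Type*} [AddCommMonoid M] (f : ℕ → E) (F : E → M) (i : ℕ)
    (v : E) : ∑ k ∈ Finset.range (i + 1), F (Function.update f i v k) =
      ∑ k ∈ Finset.range i, F (f k) + F v := by
  rw [Finset.sum_range_succ, Function.update_self]
  congr 1
  refine Finset.sum_congr rfl fun k hk => ?_
  rw [Function.update_of_ne (Finset.mem_range.1 hk).ne]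

theorem forall_lt_succ_update {E : Type*} {f : ℕ → E} {P : E → Prop} {i : ℕ} {v : E}
    (hf : ∀ k < i, P (f k)) (hv : P v) : ∀ k < i + 1, P (Function.update f i v k) := by
  intro k hk
  rcases Nat.lt_succ_iff_lt_or_eq.1 hk with h | rfl
  · rw [Function.update_of_ne h.ne]; exact hf k h
  · rwa [Function.update_self]

theorem invariant_init {n N : ℕ} (hn : 0 < n) (hN : 0 < N) :
    Invariant n N (init fun _ : Fin n => (N : ℝ) / n) where
  row_le := Nat.zero_le _
  lam_row _ := by simp [init, hn]
  lam_row_pos _ := by simp only [init, hn, dif_pos]; positivity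
  lam_of_lt a ha := absurd ha (Nat.not_lt_zero _)
  lam_of_gt a _ ha := by simp [init, ha]
  idx_eq h := absurd h hn.ne
  norm_out k hk := absurd hk (Nat.not_lt_zero _)
  gram a b := by simp [init]
  card_support := by simp [init]

theorem exists_mul_div_eq {n N r : ℕ} (hn : 0 < n) (h : n ∣ (r + 1) * N) :
    ∃ q : ℕ, ((r : ℝ) + 1) * ((N : ℝ) / n) = q := by
  have hn' : (n : ℝ) ≠ 0 := by positivity
  obtain ⟨q, hq⟩ := h
  refine ⟨q, ?_⟩
  have : ((r : ℝ) + 1) * N = n * q := by exact_mod_cast hq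
  rw [← mul_div_assoc, this]
  field_simp

theorem norm_stdVec_combination {n j : ℕ} (h : j + 1 < n) {α β : ℝ} (hab : α ^ 2 + β ^ 2 = 1) :
    ‖α • stdVec n j + β • stdVec n (j + 1)‖ = 1 := by
  rw [stdVec_eq_single h, stdVec_eq_single (Nat.lt_of_succ_lt h),
    ← sq_eq_sq₀ (norm_nonneg _) zero_le_one, norm_add_sq_real]
  simp [norm_smul, inner_smul_left, inner_smul_right, EuclideanSpace.inner_single_left, hab]

theorem card_support_stdVec_le (n j : ℕ) :
    (Finset.univ.filter fun a : Fin n => stdVec n j a ≠ 0).card ≤ 1 := by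
  refine Finset.card_le_one.2 fun a ha b hb => ?_
  simp only [stdVec_apply, Finset.mem_filter, Finset.mem_univ, true_and, ne_eq,
    ite_eq_right_iff, one_ne_zero, imp_false, not_not] at ha hb
  exact Fin.ext (ha.trans hb.symm)

theorem card_support_combination_le (n i j : ℕ) (α β : ℝ) :
    (Finset.univ.filter fun a : Fin n => (α • stdVec n i + β • stdVec n j) a ≠ 0).card ≤ 2 := by
  have hsub : (Finset.univ.filter fun a : Fin n => (α • stdVec n i + β • stdVec n j) a ≠ 0) ⊆
      (Finset.univ.filter fun a : Fin n => stdVec n i a ≠ 0) ∪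
        Finset.univ.filter fun a : Fin n => stdVec n j a ≠ 0 := by
    intro a
    simp only [Finset.mem_filter, Finset.mem_union, Finset.mem_univ, true_and, PiLp.add_apply,
      PiLp.smul_apply, smul_eq_mul]
    intro h
    by_contra! h0
    exact (Finset.mem_filter.1 h).2 (by rw [h0.1, h0.2, mul_zero, mul_zero, add_zero])
  have h1 := Finset.card_le_card hsub
  have h2 := Finset.card_union_le (Finset.univ.filter fun a : Fin n => stdVec n i a ≠ 0)
    (Finset.univ.filter fun a : Fin n => stdVec n j a ≠ 0)
  have h3 := card_support_stdVec_le n i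
  have h4 := card_support_stdVec_le n j
  omega

/-- A single vector is written, and the current row is not yet done. -/
theorem Invariant.single {n N : ℕ} {s : State n} (h : Invariant n N s) (hr : s.row < n)
    (h1 : 1 < s.lam s.row) :
    Invariant n N { row := s.row, idx := s.idx + 1,
                    lam := Function.update s.lam s.row (s.lam s.row - 1),
                    out := Function.update s.out s.idx (stdVec n s.row) } where
  row_le := h.row_le
  lam_row _ := by
    simp only [Function.update_self]
    rw [h.lam_row hr]
    push_cast
    ring
  lam_row_pos _ := by
    simp only [Function.update_self]
    linarith
  lam_of_lt a ha := by
    exact (Function.update_of_ne (ne_of_lt ha) _ _).trans (h.lam_of_lt a ha)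
  lam_of_gt a ha han := by
    exact (Function.update_of_ne (ne_of_gt ha) _ _).trans (h.lam_of_gt a ha han)
  idx_eq hn := absurd hn hr.ne
  norm_out := forall_lt_succ_update (P := fun v => ‖v‖ = 1) h.norm_out (by rw [stdVec_eq_single hr]; simp)
  gram a b := by
    rw [sum_range_succ_update s.out (fun v => v a * v b), h.gram]
    by_cases hab : a = b
    · subst hab
      by_cases ha : (a : ℕ) = s.row
      · simp [stdVec_apply, ha]; ring
      · simp [stdVec_apply, ha]
    · have : ¬ ((a : ℕ) = s.row ∧ (b : ℕ) = s.row) := fun hh =>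
        hab (Fin.ext (hh.1.trans hh.2.symm))
      simp only [stdVec_apply, hab, if_false]
      grind
  card_support := by
    rw [sum_range_succ_update s.out (fun v => (Finset.univ.filter fun a => v a ≠ 0).card)]
    have h2 := h.card_support
    have h3 := card_support_stdVec_le n s.row
    simp only
    omega

/-- A single vector is written, and it completes the current row. -/
theorem Invariant.single_last {n N : ℕ} (hn : 0 < n) (hN : 0 < N) {s : State n}
    (h : Invariant n N s) (hr : s.row < n) (h1 : s.lam s.row = 1) :
    Invariant n N { row := s.row + 1, idx := s.idx + 1,
                    lam := Function.update s.lam s.row (s.lam s.row - 1),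
                    out := Function.update s.out s.idx (stdVec n s.row) } where
  row_le := hr
  lam_row hr' := by
    have h2 := h.lam_row hr
    simp only
    rw [Function.update_of_ne (Nat.succ_ne_self _), h.lam_of_gt _ (Nat.lt_succ_self _) hr']
    push_cast
    linarith
  lam_row_pos hr' := by
    simp only
    rw [Function.update_of_ne (Nat.succ_ne_self _), h.lam_of_gt _ (Nat.lt_succ_self _) hr']
    positivity
  lam_of_lt a ha := by
    rcases Nat.lt_succ_iff_lt_or_eq.1 ha with ha | rfl
    · exact (Function.update_of_ne ha.ne _ _).trans (h.lam_of_lt a ha)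
    · simp [h1]
  lam_of_gt a ha han := by
    have ha' : s.row < a := Nat.lt_of_succ_lt ha
    exact (Function.update_of_ne (ne_of_gt ha') _ _).trans (h.lam_of_gt a ha' han)
  idx_eq hrn := by
    have h2 := h.lam_row hr
    have hn' : (n : ℝ) ≠ 0 := by positivity
    have h3 : (s.row : ℝ) + 1 = n := by exact_mod_cast hrn
    -- In the last row the partial sum is `N`, so a remainder of 1 means that exactly one vector is
    -- missing.
    rw [h3, h1, mul_div_cancel₀ _ hn'] at h2
    have h4 : (s.idx : ℝ) + 1 = N := by linarith
    exact_mod_cast h4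
  norm_out := forall_lt_succ_update (P := fun v => ‖v‖ = 1) h.norm_out (by rw [stdVec_eq_single hr]; simp)
  gram a b := by
    rw [sum_range_succ_update s.out (fun v => v a * v b), h.gram]
    by_cases hab : a = b
    · subst hab
      by_cases ha : (a : ℕ) = s.row
      · simp [stdVec_apply, ha]; ring
      · simp [stdVec_apply, ha]
    · have : ¬ ((a : ℕ) = s.row ∧ (b : ℕ) = s.row) := fun hh =>
        hab (Fin.ext (hh.1.trans hh.2.symm))
      simp only [stdVec_apply, hab, if_false]
      grind
  card_support := by
    rw [sum_range_succ_update s.out (fun v => (Finset.univ.filter fun a => v a ≠ 0).card)]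
    have h2 := h.card_support
    have h3 := card_support_stdVec_le n s.row
    have h4 := cutRows_succ n N s.row
    simp only
    omega

/-- A pair of vectors is written. -/
theorem Invariant.pair {n N : ℕ} (hn : 0 < n) (hN : 2 * n ≤ N) {s : State n}
    (h : Invariant n N s) (hr : s.row < n) (h1 : s.lam s.row < 1) :
    Invariant n N
      { row := s.row + 1
        idx := s.idx + 2
        lam := Function.update
          (Function.update s.lam (s.row + 1) (s.lam (s.row + 1) - (2 - s.lam s.row))) s.row 0
        out := Function.update
          (Function.update s.out s.idx
            (√(s.lam s.row / 2) • stdVec n s.row + √(1 - s.lam s.row / 2) • stdVec n (s.row + 1)))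
          (s.idx + 1)
            (√(s.lam s.row / 2) • stdVec n s.row -
              √(1 - s.lam s.row / 2) • stdVec n (s.row + 1)) } := by
  have hpos := h.lam_row_pos hr
  have hlam := h.lam_row hr
  -- An integral partial sum would make the remainder an integer strictly between 0 and 1.
  have hcut : ¬ n ∣ (s.row + 1) * N := fun hd => by
    obtain ⟨q, hq⟩ := exists_mul_div_eq hn hd
    rw [hq] at hlam
    have h2 : s.idx < q := by
      have : (s.idx : ℝ) < q := by linarith
      exact_mod_cast this
    have h3 : q < s.idx + 1 := by
      have : (q : ℝ) < s.idx + 1 := by linarith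
      exact_mod_cast this
    omega
  -- The last partial sum is the integer `N`, so a pair never starts in the last row.
  have hr' : s.row + 1 < n := lt_of_le_of_ne hr fun he => hcut (by rw [he]; exact dvd_mul_right n N)
  -- The next row keeps `N / n - (2 - lam)`, which is positive because `N / n ≥ 2` and `lam > 0`.
  have hc : (2 : ℝ) ≤ (N : ℝ) / n := by
    rw [le_div_iff₀ (by positivity)]
    exact_mod_cast hN
  have hnext := h.lam_of_gt _ (Nat.lt_succ_self _) hr'
  have hα : √(s.lam s.row / 2) ^ 2 = s.lam s.row / 2 := Real.sq_sqrt (by linarith)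
  have hβ : √(1 - s.lam s.row / 2) ^ 2 = 1 - s.lam s.row / 2 := Real.sq_sqrt (by linarith)
  rw [sub_eq_add_neg (√(s.lam s.row / 2) • stdVec n s.row), ← neg_smul]
  generalize √(s.lam s.row / 2) = α at hα ⊢
  generalize √(1 - s.lam s.row / 2) = β at hβ ⊢
  refine ⟨hr, fun _ => ?_, fun _ => ?_, fun a ha => ?_, fun a ha han => ?_,
    fun he => absurd he hr'.ne, ?_, fun a b => ?_, ?_⟩
  · simp only
    rw [Function.update_of_ne (Nat.succ_ne_self _), Function.update_self, hnext, hlam]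
    push_cast
    ring
  · simp only
    rw [Function.update_of_ne (Nat.succ_ne_self _), Function.update_self, hnext]
    linarith
  · rcases Nat.lt_succ_iff_lt_or_eq.1 ha with ha' | rfl
    · simp only
      rw [Function.update_of_ne ha'.ne, Function.update_of_ne (ne_of_lt ha)]
      exact h.lam_of_lt a ha'
    · simp
  · replace ha : s.row + 1 < a := ha
    have ha' : s.row < a := Nat.lt_of_succ_lt ha
    simp only
    rw [Function.update_of_ne (ne_of_gt ha'), Function.update_of_ne (ne_of_gt ha)]
    exact h.lam_of_gt a ha' han
  · have hfst := forall_lt_succ_update (P := fun v => ‖v‖ = 1) h.norm_out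
      (norm_stdVec_combination hr' (α := α) (β := β) (by rw [hα, hβ]; ring))
    exact forall_lt_succ_update (i := s.idx + 1) (P := fun v => ‖v‖ = 1) hfst
      (norm_stdVec_combination hr' (α := α) (β := -β) (by rw [neg_sq, hα, hβ]; ring))
  · simp only
    rw [show s.idx + 2 = s.idx + 1 + 1 from rfl,
      sum_range_succ_update _ (fun v : EuclideanSpace ℝ (Fin n) => v a * v b),
      sum_range_succ_update s.out (fun v => v a * v b), h.gram]
    simp only [PiLp.add_apply, PiLp.smul_apply, smul_eq_mul, stdVec_apply]
    by_cases hab : a = b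
    · subst hab
      by_cases ha : (a : ℕ) = s.row
      · simp only [ha, if_true, Function.update_self, (Nat.succ_ne_self s.row).symm, if_false]
        linear_combination 2 * hα
      · by_cases ha' : (a : ℕ) = s.row + 1
        · simp only [ha', if_true, Function.update_self, Nat.succ_ne_self s.row, if_false,
            ne_eq, not_false_eq_true, Function.update_of_ne]
          linear_combination 2 * hβ
        · simp [ha, ha', Function.update_of_ne]
    · have hab' : (a : ℕ) ≠ b := fun hh => hab (Fin.ext hh)
      simp only [hab, if_false]
      -- The opposite signs make the mixed products `α * β` and `-(α * β)` cancel.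
      split_ifs <;> first | omega | ring
  · simp only
    rw [show s.idx + 2 = s.idx + 1 + 1 from rfl, sum_range_succ_update _
        (fun v : EuclideanSpace ℝ (Fin n) => (Finset.univ.filter fun a => v a ≠ 0).card),
      sum_range_succ_update s.out (fun v => (Finset.univ.filter fun a => v a ≠ 0).card)]
    -- Two supports of size at most 2: two entries for the vectors, two more for the cut row.
    have h2 := h.card_support
    have h3 := card_support_combination_le n s.row (s.row + 1) α β
    have h4 := card_support_combination_le n s.row (s.row + 1) α (-β)
    have h5 := cutRows_succ n N s.row
    rw [if_neg hcut] at h5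
    omega

theorem Invariant.step {n N : ℕ} (hn : 0 < n) (hN : 2 * n ≤ N) {s : State n}
    (h : Invariant n N s) :
    Invariant n N (step s) ∧ (s.row < n → s.idx + 1 ≤ (SpectralTetris.step s).idx) := by
  unfold SpectralTetris.step
  by_cases hr : s.row < n
  · rw [if_pos hr]
    rcases lt_trichotomy (s.lam s.row) 1 with h1 | h1 | h1
    · have hb : (body s).lam s.row = 0 := by simp [body, h1]
      rw [if_pos hb]
      simp only [body, h1, if_true]
      exact ⟨h.pair hn hN hr h1, fun _ => by omega⟩
    · have hb : (body s).lam s.row = 0 := by simp [body, h1]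
      rw [if_pos hb]
      simp only [body, not_lt.2 h1.ge, if_false]
      exact ⟨h.single_last hn (by omega) hr h1, fun _ => le_rfl⟩
    · have hb : (body s).lam s.row ≠ 0 := by
        simp only [body, not_lt.2 h1.le, if_false, Function.update_self]
        linarith
      rw [if_neg hb]
      simp only [body, not_lt.2 h1.le, if_false]
      exact ⟨h.single hr h1, fun _ => le_rfl⟩
  · rw [if_neg hr]
    exact ⟨h, fun h' => absurd h' hr⟩

theorem row_step_eq {n : ℕ} {s : State n} (h : ¬ s.row < n) : step s = s := if_neg h

/-- The second part measures progress: a running algorithm writes at least one vector per iteration.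
-/
theorem invariant_iterate {n N : ℕ} (hn : 0 < n) (hN : 2 * n ≤ N) (t : ℕ) :
    Invariant n N (step^[t] (init fun _ : Fin n => (N : ℝ) / n)) ∧
      ((step^[t] (init fun _ : Fin n => (N : ℝ) / n)).row < n →
        t ≤ (step^[t] (init fun _ : Fin n => (N : ℝ) / n)).idx) := by
  induction t with
  | zero => exact ⟨invariant_init hn (by omega), fun _ => Nat.zero_le _⟩
  | succ t ih =>
    rw [Function.iterate_succ_apply']
    generalize step^[t] (init fun _ : Fin n => (N : ℝ) / n) = s at ih
    obtain ⟨hi, ht⟩ := ih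
    obtain ⟨hi', hs⟩ := hi.step hn hN
    refine ⟨hi', fun hr => ?_⟩
    by_cases hsr : s.row < n
    · have := ht hsr
      have := hs hsr
      omega
    · rw [row_step_eq hsr] at hr
      exact absurd hr hsr

theorem invariant_finalState {n N : ℕ} (hn : 0 < n) (hN : 2 * n ≤ N) :
    Invariant n N (finalState N fun _ : Fin n => (N : ℝ) / n) :=
  (invariant_iterate hn hN N).1

theorem terminates_const {n N : ℕ} (hn : 0 < n) (hN : 2 * n ≤ N) :
    Terminates N fun _ : Fin n => (N : ℝ) / n := by
  obtain ⟨h, ht⟩ := invariant_iterate hn hN N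
  have hrow : (finalState N fun _ : Fin n => (N : ℝ) / n).row = n := by
    refine le_antisymm h.row_le (not_lt.1 fun hr => ?_)
    -- A run still unfinished after `N` iterations would have written at least `N` vectors, yet its
    -- positive remainder forces fewer than `N`.
    have h1 := h.lam_row hr
    have h2 := h.lam_row_pos hr
    have h3 : (N : ℝ) ≤ (step^[N] (init fun _ : Fin n => (N : ℝ) / n)).idx := by
      exact_mod_cast ht hr
    have h4 : ((step^[N] (init fun _ : Fin n => (N : ℝ) / n)).row + 1 : ℝ) * ((N : ℝ) / n) ≤
        n * ((N : ℝ) / n) := by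
      refine mul_le_mul_of_nonneg_right ?_ (by positivity)
      exact_mod_cast hr
    rw [mul_div_cancel₀ _ (by positivity : (n : ℝ) ≠ 0)] at h4
    linarith
  exact ⟨hrow, h.idx_eq hrow⟩

theorem isUnitNorm_STF {n N : ℕ} (hn : 0 < n) (hN : 2 * n ≤ N) :
    IsUnitNorm (STF N fun _ : Fin n => (N : ℝ) / n) := fun i =>
  (invariant_finalState hn hN).norm_out i ((terminates_const hn hN).2.symm ▸ i.2)

theorem hasFlatRows_STF {n N : ℕ} (hn : 0 < n) (hN : 2 * n ≤ N) :
    HasFlatRows (STF N fun _ : Fin n => (N : ℝ) / n) ((N : ℝ) / n) := by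
  intro a b
  have h := invariant_finalState hn hN
  obtain ⟨hr, hi⟩ := terminates_const hn hN
  have h1 := h.gram a b
  rw [hi, h.lam_of_lt a (hr.symm ▸ a.2), sub_zero, Finset.sum_range] at h1
  exact h1

/-- The invariant only bounds the supports from above. Equality comes from the lower bound valid for
every such frame. -/
theorem sum_card_support_STF {n N : ℕ} (hn : 0 < n) (hN : 2 * n ≤ N) :
    ∑ i, (Finset.univ.filter fun a => STF N (fun _ : Fin n => (N : ℝ) / n) i a ≠ 0).card =
      N + 2 * (n - Nat.gcd N n) := by
  refine le_antisymm ?_ (le_sum_card_support hn (isUnitNorm_STF hn hN) (hasFlatRows_STF hn hN))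
  have h := (invariant_finalState hn hN).card_support
  obtain ⟨hr, hi⟩ := terminates_const hn hN
  rw [hi, hr, cutRows_self hn, Finset.sum_range] at h
  exact h

theorem isSparse_STF {n N : ℕ} (hn : 0 < n) (hN : 2 * n ≤ N) :
    IsSparse (EuclideanSpace.basisFun (Fin n) ℝ) (N + 2 * (n - Nat.gcd N n))
      (STF N fun _ : Fin n => (N : ℝ) / n) :=
  (isSparse_basisFun_iff _).2 ⟨_, fun _ _ h => Finset.mem_filter.2 ⟨Finset.mem_univ _, h⟩,
    sum_card_support_STF hn hN⟩

theorem le_of_isSparse {n N k : ℕ} (hn : 0 < n) {φ : Fin N → EuclideanSpace ℝ (Fin n)}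
    (hu : IsUnitNorm φ) (h : HasFlatRows φ ((N : ℝ) / n))
    (hk : IsSparse (EuclideanSpace.basisFun (Fin n) ℝ) k φ) :
    N + 2 * (n - Nat.gcd N n) ≤ k := by
  obtain ⟨J, hJ, rfl⟩ := (isSparse_basisFun_iff φ).1 hk
  exact (le_sum_card_support hn hu h).trans (Finset.sum_le_sum fun i _ =>
    Finset.card_le_card fun a ha => hJ i a (Finset.mem_filter.1 ha).2)

theorem isOptimallySparse_STF {n N : ℕ} (hn : 0 < n) (hN : 2 * n ≤ N) :
    IsOptimallySparse (EuclideanSpace.basisFun (Fin n) ℝ) (unitNormTightFrames n N)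
      (STF N fun _ : Fin n => (N : ℝ) / n) := by
  have hmem := mem_unitNormTightFrames_iff (N := N) hn (by omega)
  refine ⟨(hmem _).2 ⟨isUnitNorm_STF hn hN, hasFlatRows_STF hn hN⟩, _, isSparse_STF hn hN, ?_⟩
  rintro ⟨ψ, hψ, k, hk, hs⟩
  obtain ⟨hu, hf⟩ := (hmem ψ).1 hψ
  exact absurd (le_of_isSparse hn hu hf hs) (not_le.2 hk)

end SpectralTetris

theorem mainTheorem4 (n N : ℕ) (hn : 0 < n) (hN : 2 * n ≤ N) :
    SpectralTetris.Terminates N (fun _ : Fin n => (N : ℝ) / n) ∧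
    SpectralTetris.STF N (fun _ : Fin n => (N : ℝ) / n) ∈
      SpectralTetris.unitNormTightFrames n N ∧
    SpectralTetris.IsOptimallySparse (EuclideanSpace.basisFun (Fin n) ℝ)
      (SpectralTetris.unitNormTightFrames n N)
      (SpectralTetris.STF N (fun _ : Fin n => (N : ℝ) / n)) ∧
    SpectralTetris.IsOptimallySparse (EuclideanSpace.basisFun (Fin n) ℝ)
      (SpectralTetris.frameClass N (fun _ : Fin n => (N : ℝ) / n))
      (SpectralTetris.STF N (fun _ : Fin n => (N : ℝ) / n)) ∧
    IsLeast {k : ℕ | SpectralTetris.IsSparse (EuclideanSpace.basisFun (Fin n) ℝ) k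
      (SpectralTetris.STF N (fun _ : Fin n => (N : ℝ) / n))} (N + 2 * (n - Nat.gcd N n)) ∧
    SpectralTetris.maximalBlockNumber (fun _ : Fin n => (N : ℝ) / n) = Nat.gcd N n := by
  have hN0 : 0 < N := by omega
  have hopt := SpectralTetris.isOptimallySparse_STF hn hN
  refine ⟨SpectralTetris.terminates_const hn hN, hopt.1, hopt, ?_,
    ⟨SpectralTetris.isSparse_STF hn hN, fun k hk => ?_⟩,
    SpectralTetris.maximalBlockNumber_const hn hN0⟩
  · rwa [SpectralTetris.frameClass_const_eq hn hN0]
  · exact SpectralTetris.le_of_isSparse hn (SpectralTetris.isUnitNorm_STF hn hN)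
      (SpectralTetris.hasFlatRows_STF hn hN) hk
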